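/- A \emph{trunc} is an archimedean (real) vector lattice $G$ equipped with a unary operation $g\mapsto\overline{g}$ on its positive cone $G^+$ such that, for all $g,h\in G^+$: (T1) $g\wedge\overline{h}\le\overline{g}\le g$; (T2) if $\overline{g}=0$ then $g=0$; (T3) if $ng=\overline{ng}$ for all $n\in\mathbb{N}$ then $g=0$. Here archimedean means that $g=0$ whenever $g\in G^+$, $h\in G$ and $ng\le h$ for all $n\in\mathbb{N}$. A \emph{truncation homomorphism} $\theta\colon G\to H$ is a vector lattice homomorphism with $\theta(\overline{g})=\overline{\theta(g)}$ for all $g\in G^+$. Put $\overline{G}=\{\overline{g}: g\in G^+\}$. An element $u\in\overline{G}$ is a \emph{unital component} of $G$ if $(u\wedge g)\wedge(g-u\wedge g)=0$ for every $g\in\overline{G}$; let $\mathcal{UC}(G)$ denote the set of unital components, ordered as a subset of $G$. The trunc $G$ is \emph{simple} if every element of $G$ is a linear combination of unital components, and $\mathbf{sT}$ is the category of simple truncs and truncation homomorphisms. A \emph{generalized Boolean algebra} is a distributive lattice $L$ with a least element $\bot$ such that for all $a,b\in L$ there is $c\in L$ with $c\vee b=a\vee b$ and $c\wedge b=\bot$;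 $\mathbf{gBa}$ is the category of generalized Boolean algebras and lattice homomorphisms preserving $\bot$. \textbf{Theorem.} For every trunc $G$ the set $\mathcal{UC}(G)$ is a generalized Boolean algebra, with joins and meets as in $G$ and with $\bot=0$, and every truncation homomorphism $G\to H$ restricts to a $\mathbf{gBa}$-morphism $\mathcal{UC}(G)\to\mathcal{UC}(H)$. The resulting functor $\mathcal{UC}\colon\mathbf{sT}\to\mathbf{gBa}$ is an equivalence of categories. -/

import Mathlib

open CategoryTheory

universe u

namespace SimpleTruncs

/-! ### Vector lattices and truncs -/

/-- A (real) vector lattice. -/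
class VectorLattice (G : Type u) extends AddCommGroup G, Lattice G, IsOrderedAddMonoid G,
  Module ℝ G, IsOrderedModule ℝ G

/-- A trunc: an archimedean vector lattice equipped with a truncation `g ↦ trunc g`, a unary
operation on the positive cone. The archimedean property is the one for lattice-ordered groups
(no nonzero positive element has all its multiples bounded by one element). -/
class TruncatedVectorLattice (G : Type u) extends VectorLattice G where
  archimedean : ∀ g h : G, 0 ≤ g → (∀ n : ℕ, n • g ≤ h) → g = 0
  trunc : {g : G // 0 ≤ g} → {g : G // 0 ≤ g}
  inf_trunc_le : ∀ g h : {g : G // 0 ≤ g}, (g : G) ⊓ (trunc h : G) ≤ (trunc g : G)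
  trunc_le : ∀ g : {g : G // 0 ≤ g}, (trunc g : G) ≤ (g : G)
  eq_zero_of_trunc_eq_zero : ∀ g : {g : G // 0 ≤ g}, (trunc g : G) = 0 → (g : G) = 0
  eq_zero_of_nsmul_eq_trunc : ∀ g : {g : G // 0 ≤ g},
    (∀ n : ℕ, n • (g : G) = (trunc ⟨n • (g : G), nsmul_nonneg g.2 n⟩ : G)) → (g : G) = 0

open TruncatedVectorLattice (trunc)

/-- Vector lattice homomorphisms. -/
structure VectorLatticeHom (G H : Type u) [VectorLattice G] [VectorLattice H]
    extends G →ₗ[ℝ] H where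
  map_sup' : ∀ a b : G, toFun (a ⊔ b) = toFun a ⊔ toFun b
  map_inf' : ∀ a b : G, toFun (a ⊓ b) = toFun a ⊓ toFun b

namespace VectorLatticeHom

variable {G H : Type u} [VectorLattice G] [VectorLattice H]

instance : FunLike (VectorLatticeHom G H) G H where
  coe f := f.toFun
  coe_injective f g h := by
    rcases f with ⟨f, _, _⟩
    rcases g with ⟨g, _, _⟩
    have : f = g := LinearMap.ext (fun x => congrFun h x)
    subst this
    rfl

theorem map_nonneg (f : VectorLatticeHom G H) {g : G} (hg : 0 ≤ g) : 0 ≤ f g := by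
  have h : f (g ⊔ 0) = f g ⊔ f 0 := f.map_sup' g 0
  have h0 : f 0 = 0 := f.toLinearMap.map_zero
  rw [sup_of_le_left hg, h0] at h
  exact left_eq_sup.mp h

end VectorLatticeHom

/-- Truncation homomorphisms: vector lattice homomorphisms `θ` such that
`θ (trunc g) = trunc (θ g)` for all `g ≥ 0`. -/
structure TruncHom (G H : Type u) [TruncatedVectorLattice G] [TruncatedVectorLattice H]
    extends VectorLatticeHom G H where
  map_trunc' : ∀ g : {g : G // 0 ≤ g}, toVectorLatticeHom (trunc g : G) =
    (trunc ⟨toVectorLatticeHom (g : G), toVectorLatticeHom.map_nonneg g.2⟩ : H)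

namespace TruncHom

section
variable {G H K : Type u} [TruncatedVectorLattice G] [TruncatedVectorLattice H]
  [TruncatedVectorLattice K]

instance : FunLike (TruncHom G H) G H where
  coe f := f.toVectorLatticeHom
  coe_injective f g h := by
    rcases f with ⟨f, _⟩
    rcases g with ⟨g, _⟩
    have : f = g := DFunLike.coe_injective h
    subst this
    rfl

@[ext]
theorem ext {f g : TruncHom G H} (h : ∀ x, f x = g x) : f = g := DFunLike.ext f g h

theorem map_zero (f : TruncHom G H) : f 0 = 0 := f.toLinearMap.map_zero

theorem map_add (f : TruncHom G H) (a b : G) : f (a + b) = f a + f b := f.toLinearMap.map_add a b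

theorem map_sup (f : TruncHom G H) (a b : G) : f (a ⊔ b) = f a ⊔ f b := f.map_sup' a b

theorem map_inf (f : TruncHom G H) (a b : G) : f (a ⊓ b) = f a ⊓ f b := f.map_inf' a b

theorem map_nonneg (f : TruncHom G H) {g : G} (hg : 0 ≤ g) : 0 ≤ f g :=
  f.toVectorLatticeHom.map_nonneg hg

theorem map_trunc (f : TruncHom G H) (g : {g : G // 0 ≤ g}) :
    f (trunc g : G) = (trunc ⟨f (g : G), f.map_nonneg g.2⟩ : H) := f.map_trunc' g

/-- The identity truncation homomorphism. -/
def id (G : Type u) [TruncatedVectorLattice G] : TruncHom G G where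
  toLinearMap := LinearMap.id
  map_sup' _ _ := rfl
  map_inf' _ _ := rfl
  map_trunc' _ := rfl

/-- Composition of truncation homomorphisms. -/
def comp (g : TruncHom H K) (f : TruncHom G H) : TruncHom G K where
  toLinearMap := g.toLinearMap.comp f.toLinearMap
  map_sup' a b := (congrArg g (f.map_sup a b)).trans (g.map_sup _ _)
  map_inf' a b := (congrArg g (f.map_inf a b)).trans (g.map_inf _ _)
  map_trunc' a := (congrArg g (f.map_trunc a)).trans (g.map_trunc _)

end

end TruncHom

/-- The category `T` of truncs with truncation homomorphisms: objects. -/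
structure TruncCat where
  carrier : Type u
  [str : TruncatedVectorLattice carrier]

attribute [instance] TruncCat.str

instance : Category TruncCat.{u} where
  Hom G H := TruncHom G.carrier H.carrier
  id G := TruncHom.id G.carrier
  comp f g := TruncHom.comp g f

/-! ### Generalized Boolean algebras -/

/-- Generalized Boolean homomorphisms: lattice homomorphisms preserving the bottom element. -/
structure GenBoolHom (A B : Type u) [GeneralizedBooleanAlgebra A] [GeneralizedBooleanAlgebra B]
    extends LatticeHom A B where
  map_bot' : toFun ⊥ = ⊥

namespace GenBoolHom

section
variable {A B C : Type u} [GeneralizedBooleanAlgebra A] [GeneralizedBooleanAlgebra B]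
  [GeneralizedBooleanAlgebra C]

instance : FunLike (GenBoolHom A B) A B where
  coe f := f.toFun
  coe_injective f g h := by
    rcases f with ⟨f, _⟩
    rcases g with ⟨g, _⟩
    have : f = g := DFunLike.coe_injective h
    subst this
    rfl

@[ext]
theorem ext {f g : GenBoolHom A B} (h : ∀ x, f x = g x) : f = g := DFunLike.ext f g h

/-- The identity generalized Boolean homomorphism. -/
def id (A : Type u) [GeneralizedBooleanAlgebra A] : GenBoolHom A A where
  toLatticeHom := LatticeHom.id A
  map_bot' := rfl

/-- Composition of generalized Boolean homomorphisms. -/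
def comp (g : GenBoolHom B C) (f : GenBoolHom A B) : GenBoolHom A C where
  toLatticeHom := g.toLatticeHom.comp f.toLatticeHom
  map_bot' := (congrArg g f.map_bot').trans g.map_bot'

end

end GenBoolHom

/-- The category `gBa` of generalized Boolean algebras: objects. The relative complement, a field
of Mathlib's class, is determined by the lattice structure and preserved by all morphisms. -/
structure GenBoolAlg where
  carrier : Type u
  [str : GeneralizedBooleanAlgebra carrier]

attribute [instance] GenBoolAlg.str

instance : Category GenBoolAlg.{u} where
  Hom A B := GenBoolHom A.carrier B.carrier
  id A := GenBoolHom.id A.carrier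
  comp f g := GenBoolHom.comp g f

/-! ### Unital components -/

section
variable (G : Type u) [TruncatedVectorLattice G]

/-- The range of the truncation. -/
def truncRange : Set G := Set.range fun g : {g : G // 0 ≤ g} => (trunc g : G)

variable {G}

/-- For positive elements `f` and `g`: `f` is a component of `g`. -/
def IsComponent (f g : G) : Prop := f ≤ g ∧ f ⊓ (g - f) = 0

/-- `u` is a unital component of `G`. -/
def IsUnitalComponent (u : G) : Prop :=
  u ∈ truncRange G ∧ ∀ g ∈ truncRange G, IsComponent (u ⊓ g) g

theorem nonneg_of_mem {d : G} (hd : d ∈ truncRange G) : 0 ≤ d := by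
  obtain ⟨g, rfl⟩ := hd
  exact (trunc g).2

theorem inf_mem {g d : G} (hg : 0 ≤ g) (hd : d ∈ truncRange G) : g ⊓ d ∈ truncRange G := by
  have hd0 := nonneg_of_mem hd
  obtain ⟨h, rfl⟩ := hd
  have h0 : 0 ≤ g ⊓ (trunc h : G) := le_inf hg hd0
  refine ⟨⟨_, h0⟩, le_antisymm (TruncatedVectorLattice.trunc_le _) ?_⟩
  simpa using TruncatedVectorLattice.inf_trunc_le ⟨_, h0⟩ h

theorem sup_mem {d e : G} (hd : d ∈ truncRange G) (he : e ∈ truncRange G) :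
    d ⊔ e ∈ truncRange G := by
  have h0 : 0 ≤ d ⊔ e := (nonneg_of_mem hd).trans le_sup_left
  obtain ⟨a, rfl⟩ := hd
  obtain ⟨b, rfl⟩ := he
  refine ⟨⟨_, h0⟩, le_antisymm (TruncatedVectorLattice.trunc_le _) (sup_le ?_ ?_)⟩
  · simpa using TruncatedVectorLattice.inf_trunc_le ⟨_, h0⟩ a
  · simpa using TruncatedVectorLattice.inf_trunc_le ⟨_, h0⟩ b

theorem zero_mem : (0 : G) ∈ truncRange G :=
  ⟨⟨0, le_rfl⟩, le_antisymm (TruncatedVectorLattice.trunc_le _) (trunc _).2⟩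

theorem isComponent_inf_iff {u d : G} (hu : 0 ≤ u) (hd : 0 ≤ d) :
    IsComponent (u ⊓ d) d ↔ (u + u) ⊓ d ≤ u := by
  have key : u ⊓ (d - u) ≤ 0 ↔ (u + u) ⊓ d ≤ u := by
    rw [← add_le_add_iff_left u, add_inf, add_sub_cancel, add_zero]
  rw [← key]
  have e1 : d - u ⊓ d = (d - u) ⊔ 0 := by
    rw [sub_eq_add_neg, neg_inf, add_sup, ← sub_eq_add_neg, ← sub_eq_add_neg, sub_self]
  let _ := AddCommGroup.toDistribLattice G
  constructor
  · rintro ⟨-, h⟩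
    rw [e1] at h
    have h2 : u ⊓ (d - u) ≤ (u ⊓ d) ⊓ ((d - u) ⊔ 0) :=
      le_inf (le_inf inf_le_left (inf_le_right.trans (sub_le_self d hu)))
        (inf_le_right.trans le_sup_left)
    exact h2.trans h.le
  · intro h
    refine ⟨inf_le_right, le_antisymm ?_ (le_inf (le_inf hu hd) (by rw [e1]; exact le_sup_right))⟩
    rw [e1]
    calc (u ⊓ d) ⊓ ((d - u) ⊔ 0) ≤ u ⊓ ((d - u) ⊔ 0) := inf_le_inf_right _ inf_le_left
      _ = (u ⊓ (d - u)) ⊔ (u ⊓ 0) := inf_sup_left _ _ _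
      _ ≤ 0 := sup_le h inf_le_right

theorem isUnitalComponent_iff {u : G} : IsUnitalComponent u ↔
    u ∈ truncRange G ∧ ∀ d ∈ truncRange G, (u + u) ⊓ d ≤ u := by
  constructor
  · rintro ⟨h1, h2⟩
    exact ⟨h1, fun d hd => (isComponent_inf_iff (nonneg_of_mem h1) (nonneg_of_mem hd)).1 (h2 d hd)⟩
  · rintro ⟨h1, h2⟩
    exact ⟨h1, fun d hd => (isComponent_inf_iff (nonneg_of_mem h1) (nonneg_of_mem hd)).2 (h2 d hd)⟩

/-- The unital components are the `u ≥ 0` with `u = trunc (2 u)`. -/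
theorem isUnitalComponent_iff_trunc {u : G} : IsUnitalComponent u ↔
    ∃ h : 0 ≤ u, u = (trunc ⟨u + u, add_nonneg h h⟩ : G) := by
  rw [isUnitalComponent_iff]
  constructor
  · rintro ⟨h1, h2⟩
    have h := nonneg_of_mem h1
    refine ⟨h, le_antisymm ?_ ?_⟩
    · obtain ⟨a, ha⟩ := h1
      have := TruncatedVectorLattice.inf_trunc_le ⟨u + u, add_nonneg h h⟩ a
      simp only at ha
      rw [ha] at this
      exact (le_inf (le_add_of_nonneg_left h) le_rfl).trans this
    · exact (le_inf (TruncatedVectorLattice.trunc_le _) le_rfl).trans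
        (h2 _ ⟨⟨u + u, add_nonneg h h⟩, rfl⟩)
  · rintro ⟨h, e⟩
    refine ⟨⟨_, e.symm⟩, ?_⟩
    rintro _ ⟨a, rfl⟩
    have := TruncatedVectorLattice.inf_trunc_le ⟨u + u, add_nonneg h h⟩ a
    rwa [← e] at this

namespace IsUnitalComponent

variable {u v : G}

theorem nonneg (hu : IsUnitalComponent u) : 0 ≤ u := nonneg_of_mem hu.1

theorem zero : IsUnitalComponent (0 : G) :=
  isUnitalComponent_iff.2 ⟨zero_mem, fun d _ => by rw [add_zero]; exact inf_le_left⟩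

theorem sup (hu : IsUnitalComponent u) (hv : IsUnitalComponent v) : IsUnitalComponent (u ⊔ v) := by
  let _ := AddCommGroup.toDistribLattice G
  have hu' := isUnitalComponent_iff.1 hu
  have hv' := isUnitalComponent_iff.1 hv
  refine isUnitalComponent_iff.2 ⟨sup_mem hu.1 hv.1, fun d hd => ?_⟩
  have e : (u ⊔ v) + (u ⊔ v) = (u + u) ⊔ (v + v) := by
    rw [← two_nsmul, ← two_nsmul, ← two_nsmul, ← Nat.cast_smul_eq_nsmul ℝ,
      ← Nat.cast_smul_eq_nsmul ℝ, ← Nat.cast_smul_eq_nsmul ℝ]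
    exact (OrderIso.smulRight (β := G) (a := ((2 : ℕ) : ℝ)) (by norm_num)).map_sup u v
  have e2 : ((u + u) ⊔ (v + v)) ⊓ d = ((u + u) ⊓ d) ⊔ ((v + v) ⊓ d) := inf_sup_right _ _ _
  rw [e, e2]
  exact sup_le_sup (hu'.2 d hd) (hv'.2 d hd)

theorem inf (hu : IsUnitalComponent u) (hv : IsUnitalComponent v) : IsUnitalComponent (u ⊓ v) := by
  have hu' := isUnitalComponent_iff.1 hu
  have hv' := isUnitalComponent_iff.1 hv
  refine isUnitalComponent_iff.2 ⟨inf_mem hu.nonneg hv.1, fun d hd => le_inf ?_ ?_⟩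
  · exact (inf_le_inf_right d (add_le_add inf_le_left inf_le_left)).trans (hu'.2 d hd)
  · exact (inf_le_inf_right d (add_le_add inf_le_right inf_le_right)).trans (hv'.2 d hd)

theorem inf_inf_sub (hu : IsUnitalComponent u) (hv : IsUnitalComponent v) :
    (u ⊓ v) ⊓ (u - u ⊓ v) = 0 := by
  have := (hv.2 u hu.1).2
  rwa [inf_comm v u] at this

theorem inf_sup_sub (hu : IsUnitalComponent u) (hv : IsUnitalComponent v) :
    (u ⊓ v) ⊔ (u - u ⊓ v) = u := by
  have := inf_add_sup (u ⊓ v) (u - u ⊓ v)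
  rw [inf_inf_sub hu hv, zero_add] at this
  rw [this, add_sub_cancel]

theorem sub_inf (hu : IsUnitalComponent u) (hv : IsUnitalComponent v) :
    IsUnitalComponent (u - u ⊓ v) := by
  let _ := AddCommGroup.toDistribLattice G
  have hu' := isUnitalComponent_iff.1 hu
  have h0 : 0 ≤ u - u ⊓ v := sub_nonneg.2 inf_le_left
  have hle : u - u ⊓ v ≤ u := sub_le_self _ (le_inf hu.nonneg hv.nonneg)
  refine isUnitalComponent_iff.2 ⟨?_, fun d hd => ?_⟩
  · have := inf_mem h0 hu.1
    rwa [inf_of_le_left hle] at this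
  · set c := u - u ⊓ v with hc
    have hxu : (c + c) ⊓ d ≤ u := (inf_le_inf_right d (add_le_add hle hle)).trans (hu'.2 d hd)
    have hw : (u ⊓ v) ⊓ (c + c) ≤ 0 := by
      have hcw : (u ⊓ v) ⊓ c = 0 := inf_inf_sub hu hv
      have h1 : (u ⊓ v) ⊓ (c + c) ≤ c := by
        have : (u ⊓ v) ⊓ (c + c) ≤ ((u ⊓ v) + c) ⊓ (c + c) :=
          inf_le_inf_right _ (le_add_of_nonneg_right h0)
        rwa [← inf_add, hcw, zero_add] at this
      exact (le_inf inf_le_left h1).trans hcw.le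
    calc (c + c) ⊓ d = ((c + c) ⊓ d) ⊓ ((u ⊓ v) ⊔ c) := by
          rw [inf_sup_sub hu hv, inf_of_le_left hxu]
      _ = (((c + c) ⊓ d) ⊓ (u ⊓ v)) ⊔ (((c + c) ⊓ d) ⊓ c) := inf_sup_left _ _ _
      _ ≤ c := sup_le ((le_inf inf_le_right (inf_le_left.trans inf_le_left)).trans
          (hw.trans h0)) inf_le_right

theorem map {H : Type u} [TruncatedVectorLattice H] (f : TruncHom G H)
    (hu : IsUnitalComponent u) : IsUnitalComponent (f u) := by
  obtain ⟨h, e⟩ := isUnitalComponent_iff_trunc.1 hu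
  refine isUnitalComponent_iff_trunc.2 ⟨f.map_nonneg h, ?_⟩
  have h2 := f.map_trunc ⟨u + u, add_nonneg h h⟩
  rw [← e] at h2
  simp only [f.map_add] at h2
  exact h2

end IsUnitalComponent

variable (G)

/-- The family of unital components of `G`. -/
def UC : Type u := {u : G // IsUnitalComponent u}

/-- The unital components, ordered as a subset of `G`, form a generalized Boolean algebra; joins
and meets are those of `G`, the bottom is `0`. -/
noncomputable instance : GeneralizedBooleanAlgebra (UC G) where
  le u v := u.1 ≤ v.1
  le_refl u := le_refl u.1
  le_trans _ _ _ h1 h2 := le_trans (α := G) h1 h2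
  le_antisymm _ _ h1 h2 := Subtype.ext (le_antisymm h1 h2)
  sup u v := ⟨u.1 ⊔ v.1, u.2.sup v.2⟩
  inf u v := ⟨u.1 ⊓ v.1, u.2.inf v.2⟩
  le_sup_left _ _ := le_sup_left (α := G)
  le_sup_right _ _ := le_sup_right (α := G)
  sup_le _ _ _ h1 h2 := sup_le (α := G) h1 h2
  inf_le_left _ _ := inf_le_left (α := G)
  inf_le_right _ _ := inf_le_right (α := G)
  le_inf _ _ _ h1 h2 := le_inf (α := G) h1 h2
  le_sup_inf u v w := (AddCommGroup.toDistribLattice G).le_sup_inf u.1 v.1 w.1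
  bot := ⟨0, IsUnitalComponent.zero⟩
  sdiff u v := ⟨u.1 - u.1 ⊓ v.1, u.2.sub_inf v.2⟩
  sup_inf_sdiff u v := Subtype.ext (u.2.inf_sup_sub v.2)
  inf_inf_sdiff u v := Subtype.ext (u.2.inf_inf_sub v.2)

variable {G} in
/-- A truncation homomorphism `G → H` restricts to a map `UC G → UC H`. -/
def UC.map {H : Type u} [TruncatedVectorLattice H] (f : TruncHom G H) :
    GenBoolHom (UC G) (UC H) where
  toFun u := ⟨f u.1, u.2.map f⟩
  map_sup' u v := Subtype.ext (f.map_sup u.1 v.1)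
  map_inf' u v := Subtype.ext (f.map_inf u.1 v.1)
  map_bot' := Subtype.ext f.map_zero

end

/-- The functor on truncs `G ↦ UC G`, sending a truncation homomorphism to its restriction. -/
noncomputable def truncUC : TruncCat.{u} ⥤ GenBoolAlg.{u} where
  obj G := ⟨UC G.carrier⟩
  map f := UC.map f
  map_id _ := rfl
  map_comp _ _ := rfl

/-! ### Simple truncs -/

/-- A trunc is simple if every element is a linear combination of unital components. -/
def isSimple : ObjectProperty TruncCat.{u} := fun G =>
  Submodule.span ℝ {u : G.carrier | IsUnitalComponent u} = ⊤

/-- The category `sT` of simple truncs, a full subcategory of the category of truncs. -/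
abbrev SimpleTruncCat := isSimple.{u}.FullSubcategory

/-- The functor `UC : sT ⥤ gBa`. -/
noncomputable def functorUC : SimpleTruncCat.{u} ⥤ GenBoolAlg.{u} := isSimple.ι ⋙ truncUC

end SimpleTruncs

namespace SimpleTruncs

open TruncatedVectorLattice (trunc)

/-! ### Disjointness in vector lattices -/

/-! `functorUC` is shown to be faithful, full and essentially surjective. Faithfulness is immediate,
since a simple trunc is spanned by its unital components.

The engine for the rest is disjointness. A linear combination of values of a lattice map on a
generalized Boolean algebra can be rewritten over pairwise disjoint elements
(`IsLatticeMap.exists_disjoint_sum`). Over disjoint positive elements the positive part is taken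
coefficientwise (`sum_smul_sup_zero`), and a vanishing sum vanishes termwise
(`smul_eq_zero_of_sum_smul_eq_zero`).

Fullness: given `φ : UC G → UC H`, the pairs `(u, φ u)` span a subspace of `G × H`. Termwise
vanishing makes it the graph of a linear map, and closure under positive parts makes that map a
lattice homomorphism. Truncation then comes for free: if `0 ≤ x ≤ r • u` with `u` a unital
component, the truncation of `x` is `x ⊓ u` (`IsUnitalComponent.trunc_eq_inf`).

Essential surjectivity: by Stone representation, `A` embeds as indicator functions on its prime
ideals. Their real span, truncated by `x ↦ x ⊓ 1`, is a simple trunc whose unital components are its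
functions with values `0` and `1`, and these are exactly the indicators coming from `A`. -/

instance {V W : Type u} [VectorLattice V] [VectorLattice W] : VectorLattice (V × W) where
  smul_le_smul_of_nonneg_left _ hc _ _ h :=
    ⟨smul_le_smul_of_nonneg_left h.1 hc, smul_le_smul_of_nonneg_left h.2 hc⟩
  smul_le_smul_of_nonneg_right _ hx _ _ h :=
    ⟨smul_le_smul_of_nonneg_right h hx.1, smul_le_smul_of_nonneg_right h hx.2⟩

instance {X : Type u} : VectorLattice (X → ℝ) where
  smul_le_smul_of_nonneg_left _ hc _ _ h i := smul_le_smul_of_nonneg_left (h i) hc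
  smul_le_smul_of_nonneg_right _ hx _ _ h i := smul_le_smul_of_nonneg_right h (hx i)

section VectorLattice

variable {V : Type u} [VectorLattice V]

theorem add_inf_eq_zero {a b c : V} (ha : 0 ≤ a) (hb : 0 ≤ b) (hc : 0 ≤ c)
    (hac : a ⊓ c = 0) (hbc : b ⊓ c = 0) : (a + b) ⊓ c = 0 := by
  refine le_antisymm ?_ (le_inf (add_nonneg ha hb) hc)
  -- Enlarging `c` to `c + b` lets `b` be pulled out of the infimum, so `(a + b) ⊓ c ≤ a ⊓ c + b =
  -- b`.
  have h : (a + b) ⊓ c ≤ (a + b) ⊓ (c + b) := inf_le_inf_left _ (le_add_of_nonneg_right hb)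
  rw [← inf_add, hac, zero_add] at h
  exact (le_inf h inf_le_right).trans hbc.le

theorem sum_inf_eq_zero {ι : Type*} (s : Finset ι) {f : ι → V} {c : V} (hc : 0 ≤ c)
    (hf : ∀ i ∈ s, 0 ≤ f i) (h : ∀ i ∈ s, f i ⊓ c = 0) : (∑ i ∈ s, f i) ⊓ c = 0 := by
  classical
  induction s using Finset.induction_on with
  | empty => simpa using hc
  | insert i s hi ih =>
    rw [Finset.sum_insert hi]
    rw [Finset.forall_mem_insert] at hf h
    exact add_inf_eq_zero hf.1 (Finset.sum_nonneg hf.2) hc h.1 (ih hf.2 h.2)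

theorem smul_inf_smul_eq_zero {a b : V} (ha : 0 ≤ a) (hb : 0 ≤ b) (hab : a ⊓ b = 0) {r s : ℝ}
    (hr : 0 ≤ r) (hs : 0 ≤ s) : (r • a) ⊓ (s • b) = 0 := by
  refine le_antisymm ?_ (le_inf (smul_nonneg hr ha) (smul_nonneg hs hb))
  -- A common scalar above both; the `+ 1` keeps it positive, so that scaling by it is an order
  -- isomorphism.
  have hm : 0 < max r s + 1 := by positivity
  calc (r • a) ⊓ (s • b) ≤ ((max r s + 1) • a) ⊓ ((max r s + 1) • b) :=
        inf_le_inf (smul_le_smul_of_nonneg_right (by linarith [le_max_left r s]) ha)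
          (smul_le_smul_of_nonneg_right (by linarith [le_max_right r s]) hb)
    _ = (max r s + 1) • (a ⊓ b) := ((OrderIso.smulRight (β := V) hm).map_inf a b).symm
    _ ≤ 0 := by rw [hab, smul_zero]

/-- A difference of disjoint elements is already the decomposition into positive and negative parts.
-/
theorem sub_sup_zero {p q : V} (h : p ⊓ q = 0) : (p - q) ⊔ 0 = p := by
  have h1 := inf_add_sup p q
  rw [h, zero_add] at h1
  rw [← sub_self q, ← sup_sub, h1, add_sub_cancel_right]

/-- With the next identity, this reduces closure of subspaces under lattice operations, and their
preservation by linear maps, to the single operation `x ↦ x ⊔ 0`. -/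
theorem sup_eq_sub_sup_zero_add (a b : V) : a ⊔ b = (a - b) ⊔ 0 + b := by
  rw [sup_add, sub_add_cancel, zero_add]

theorem inf_eq_sub_sub_sup_zero (a b : V) : a ⊓ b = a - (a - b) ⊔ 0 := by
  rw [eq_sub_iff_add_eq, ← add_right_cancel_iff (a := b), add_assoc, ← sup_eq_sub_sup_zero_add,
    inf_add_sup]

/-- A family of disjoint positive elements, with real coefficients: the positive part of the sum is
computed coefficientwise. -/
theorem sum_smul_sup_zero {ι : Type*} (s : Finset ι) {f : ι → V} (hf : ∀ i ∈ s, 0 ≤ f i)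
    (hd : ∀ i ∈ s, ∀ j ∈ s, i ≠ j → f i ⊓ f j = 0) (c : ι → ℝ) :
    (∑ i ∈ s, c i • f i) ⊔ 0 = ∑ i ∈ s, max (c i) 0 • f i := by
  have e : ∑ i ∈ s, c i • f i = ∑ i ∈ s, max (c i) 0 • f i - ∑ i ∈ s, max (-c i) 0 • f i := by
    rw [← Finset.sum_sub_distrib]
    refine Finset.sum_congr rfl fun i _ => ?_
    rw [← sub_smul]
    congr 1
    rcases le_total (c i) 0 with h | h
    · rw [max_eq_right h, max_eq_left (by linarith)]; ring
    · rw [max_eq_left h, max_eq_right (by linarith)]; ring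
  have hn : ∀ (d : ι → ℝ), ∀ i ∈ s, 0 ≤ max (d i) 0 • f i := fun d i hi =>
    smul_nonneg (le_max_right _ _) (hf i hi)
  rw [e]
  refine sub_sup_zero (sum_inf_eq_zero s (Finset.sum_nonneg (hn fun i => -c i)) (hn c)
    fun i hi => ?_)
  rw [inf_comm]
  refine sum_inf_eq_zero s (hn c i hi) (hn fun i => -c i) fun j hj => ?_
  -- On the diagonal one of `max (c i) 0` and `max (-c i) 0` is zero; off it the elements themselves
  -- are disjoint.
  by_cases hij : i = j
  · subst hij
    rcases le_total (c i) 0 with h | h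
    · rw [max_eq_right h, zero_smul, inf_eq_right]
      exact smul_nonneg (le_max_right _ _) (hf i hi)
    · rw [max_eq_right (a := -c i) (by linarith), zero_smul, inf_eq_left]
      exact hn c i hi
  · exact smul_inf_smul_eq_zero (hf j hj) (hf i hi) (hd j hj i hi (Ne.symm hij))
      (le_max_right _ _) (le_max_right _ _)

/-- The positive part of the zero sum is a zero sum of nonnegative terms, which kills the terms with
nonnegative coefficient; negating all coefficients handles the others. -/
theorem smul_eq_zero_of_sum_smul_eq_zero {ι : Type*} (s : Finset ι) {f : ι → V}
    (hf : ∀ i ∈ s, 0 ≤ f i) (hd : ∀ i ∈ s, ∀ j ∈ s, i ≠ j → f i ⊓ f j = 0) (c : ι → ℝ)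
    (h : ∑ i ∈ s, c i • f i = 0) : ∀ i ∈ s, c i • f i = 0 := by
  have key : ∀ d : ι → ℝ, ∑ i ∈ s, d i • f i = 0 → ∀ i ∈ s, max (d i) 0 • f i = 0 := by
    intro d h
    have h1 := sum_smul_sup_zero s hf hd d
    rw [h, sup_idem] at h1
    exact (Finset.sum_eq_zero_iff_of_nonneg fun i hi =>
      smul_nonneg (le_max_right _ _) (hf i hi)).1 h1.symm
  intro i hi
  rcases le_total (c i) 0 with hc | hc
  · have h1 := key (fun i => -c i) (by simp [h]) i hi
    rw [max_eq_left (by linarith), neg_smul, neg_eq_zero] at h1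
    exact h1
  · have h1 := key c h i hi
    rwa [max_eq_left hc] at h1

end VectorLattice

/-! ### Lattice maps from generalized Boolean algebras to vector lattices -/

section LatticeMap

variable {A : Type u} [GeneralizedBooleanAlgebra A] {V : Type u} [VectorLattice V]

/-- A lattice map from a generalized Boolean algebra to a vector lattice sending `⊥` to `0`. -/
structure IsLatticeMap (f : A → V) : Prop where
  map_bot : f ⊥ = 0
  map_sup : ∀ a b, f (a ⊔ b) = f a ⊔ f b
  map_inf : ∀ a b, f (a ⊓ b) = f a ⊓ f b

namespace IsLatticeMap

variable {f : A → V}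

theorem nonneg (hf : IsLatticeMap f) (a : A) : 0 ≤ f a := by
  have h := hf.map_sup a ⊥
  rw [sup_bot_eq, hf.map_bot] at h
  exact left_eq_sup.1 h

theorem mono (hf : IsLatticeMap f) {a b : A} (h : a ≤ b) : f a ≤ f b := by
  have h1 := hf.map_sup a b
  rw [sup_of_le_right h] at h1
  exact right_eq_sup.1 h1

theorem inf_eq_zero (hf : IsLatticeMap f) {a b : A} (h : Disjoint a b) : f a ⊓ f b = 0 := by
  rw [← hf.map_inf, h.eq_bot, hf.map_bot]

theorem map_sup_of_disjoint (hf : IsLatticeMap f) {a b : A} (h : Disjoint a b) :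
    f (a ⊔ b) = f a + f b := by
  rw [← inf_add_sup, hf.inf_eq_zero h, zero_add, hf.map_sup]

theorem map_finset_sup (hf : IsLatticeMap f) {ι : Type*} (s : Finset ι) (g : ι → A)
    (h : ∀ i ∈ s, ∀ j ∈ s, i ≠ j → Disjoint (g i) (g j)) :
    f (s.sup g) = ∑ i ∈ s, f (g i) := by
  classical
  induction s using Finset.induction_on with
  | empty => simpa using hf.map_bot
  | insert i s hi ih =>
    rw [Finset.sum_insert hi, Finset.sup_insert, hf.map_sup_of_disjoint, ih]
    · exact fun j hj k hk => h j (Finset.mem_insert_of_mem hj) k (Finset.mem_insert_of_mem hk)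
    · rw [Finset.disjoint_sup_right]
      intro j hj
      exact h i (Finset.mem_insert_self _ _) j (Finset.mem_insert_of_mem hj)
        (by rintro rfl; exact hi hj)

/-- A finite subset of a generalized Boolean algebra has a disjoint refinement. -/
theorem exists_disjoint_refinement (hf : IsLatticeMap f) (s : Finset A) :
    ∃ t : Finset A, (∀ a ∈ t, ∀ b ∈ t, a ≠ b → Disjoint a b) ∧
      ∀ a ∈ s, f a ∈ Submodule.span ℝ (f '' t) := by
  classical
  induction s using Finset.induction_on with
  | empty => exact ⟨∅, by simp, by simp⟩
  | insert b s _ ih =>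
    obtain ⟨t, hd, ht⟩ := ih
    -- Each old piece is cut along `b`, and the part of `b` outside all old pieces is added. Old
    -- pieces are then disjoint joins of two new ones, and `b` is a disjoint join of new ones.
    set t' : Finset A := t.image (· ⊓ b) ∪ t.image (· \ b) ∪ {b \ t.sup id} with ht'
    have mem1 : ∀ a ∈ t, a ⊓ b ∈ t' := fun a ha =>
      Finset.mem_union_left _ (Finset.mem_union_left _ (Finset.mem_image_of_mem _ ha))
    have mem2 : ∀ a ∈ t, a \ b ∈ t' := fun a ha =>
      Finset.mem_union_left _ (Finset.mem_union_right _ (Finset.mem_image_of_mem _ ha))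
    have mem3 : b \ t.sup id ∈ t' := Finset.mem_union_right _ (Finset.mem_singleton_self _)
    have hspan : ∀ a ∈ t', f a ∈ Submodule.span ℝ (f '' t') := fun a ha =>
      Submodule.subset_span ⟨a, ha, rfl⟩
    have hle : ∀ a ∈ t, f a ∈ Submodule.span ℝ (f '' t') := by
      intro a ha
      have e : f a = f (a ⊓ b) + f (a \ b) := by
        rw [← hf.map_sup_of_disjoint disjoint_inf_sdiff, sup_inf_sdiff]
      rw [e]
      exact add_mem (hspan _ (mem1 a ha)) (hspan _ (mem2 a ha))
    refine ⟨t', ?_, ?_⟩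
    · have cross : ∀ a ∈ t, ∀ a' ∈ t, Disjoint (a ⊓ b) (a' \ b) := fun a _ a' _ =>
        disjoint_sdiff_self_right.mono_left inf_le_right
      have d1 : ∀ a ∈ t, Disjoint a (b \ t.sup id) := fun a ha =>
        disjoint_sdiff_self_right.mono_left (Finset.le_sup (f := id) ha)
      have memt : ∀ x ∈ t', (∃ a ∈ t, a ⊓ b = x) ∨ (∃ a ∈ t, a \ b = x) ∨ x = b \ t.sup id := by
        intro x hx
        simp only [ht', Finset.mem_union, Finset.mem_image, Finset.mem_singleton, or_assoc] at hx
        exact hx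
      intro x hx y hy hxy
      rcases memt x hx with ⟨a, ha, rfl⟩ | ⟨a, ha, rfl⟩ | rfl <;>
      rcases memt y hy with ⟨a', ha', rfl⟩ | ⟨a', ha', rfl⟩ | rfl
      · exact (hd a ha a' ha' (by rintro rfl; exact hxy rfl)).mono inf_le_left inf_le_left
      · exact cross a ha a' ha'
      · exact (d1 a ha).mono_left inf_le_left
      · exact (cross a' ha' a ha).symm
      · exact (hd a ha a' ha' (by rintro rfl; exact hxy rfl)).mono sdiff_le sdiff_le
      · exact (d1 a ha).mono_left sdiff_le
      · exact ((d1 a' ha').mono_left inf_le_left).symm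
      · exact ((d1 a' ha').mono_left sdiff_le).symm
      · exact absurd rfl hxy
    · rw [Finset.forall_mem_insert]
      refine ⟨?_, fun a ha => ?_⟩
      · have e : f b = ∑ a ∈ t, f (a ⊓ b) + f (b \ t.sup id) := by
          rw [← hf.map_finset_sup t (· ⊓ b) fun a ha a' ha' h =>
            (hd a ha a' ha' h).mono inf_le_left inf_le_left]
          have e1 : t.sup (· ⊓ b) = b ⊓ t.sup id := by
            rw [Finset.sup_inf_distrib_left]
            exact Finset.sup_congr rfl fun a _ => inf_comm _ _
          rw [e1, ← hf.map_sup_of_disjoint disjoint_inf_sdiff, sup_inf_sdiff]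
        rw [e]
        exact add_mem (sum_mem fun a ha => hspan _ (mem1 a ha)) (hspan _ mem3)
      · refine Submodule.span_le.2 ?_ (ht a ha)
        rintro _ ⟨a, ha, rfl⟩
        exact hle a ha

/-- Every linear combination of values of a lattice map can be made disjoint. -/
theorem exists_disjoint_sum (hf : IsLatticeMap f) {x : V}
    (hx : x ∈ Submodule.span ℝ (Set.range f)) :
    ∃ (t : Finset A) (c : A → ℝ), (∀ a ∈ t, ∀ b ∈ t, a ≠ b → Disjoint a b) ∧
      x = ∑ a ∈ t, c a • f a := by
  classical
  obtain ⟨T, hT, hx⟩ := Submodule.mem_span_finite_of_mem_span hx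
  obtain ⟨s, hs⟩ : ∃ s : Finset A, s.image f = T := by
    rw [← Set.image_univ] at hT
    obtain ⟨s, -, h⟩ := Finset.subset_set_image_iff.1 hT
    exact ⟨s, h⟩
  obtain ⟨t, hd, ht⟩ := hf.exists_disjoint_refinement s
  have hx' : x ∈ Submodule.span ℝ (f '' t) := by
    refine Submodule.span_le.2 ?_ hx
    intro y hy
    rw [← hs, Finset.mem_coe, Finset.mem_image] at hy
    obtain ⟨a, ha, rfl⟩ := hy
    exact ht a ha
  rw [Submodule.mem_span_image_finset_iff_exists_fun] at hx'
  obtain ⟨c, rfl⟩ := hx'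
  refine ⟨t, fun a => if h : a ∈ t then c ⟨a, h⟩ else 0, hd, ?_⟩
  rw [← Finset.sum_coe_sort t]
  refine Finset.sum_congr rfl fun a _ => ?_
  simp only [dif_pos a.2]

/-- Over disjoint elements, the positive part only replaces each coefficient by its own positive
part. Hence the span is a vector sublattice. -/
theorem sup_zero_mem_span (hf : IsLatticeMap f) {x : V}
    (hx : x ∈ Submodule.span ℝ (Set.range f)) : x ⊔ 0 ∈ Submodule.span ℝ (Set.range f) := by
  obtain ⟨t, c, hd, rfl⟩ := hf.exists_disjoint_sum hx
  rw [sum_smul_sup_zero t (fun a _ => hf.nonneg a)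
    fun a ha b hb h => hf.inf_eq_zero (hd a ha b hb h)]
  exact sum_mem fun a _ => Submodule.smul_mem _ _ (Submodule.subset_span ⟨a, rfl⟩)

theorem sup_mem_span (hf : IsLatticeMap f) {x y : V} (hx : x ∈ Submodule.span ℝ (Set.range f))
    (hy : y ∈ Submodule.span ℝ (Set.range f)) : x ⊔ y ∈ Submodule.span ℝ (Set.range f) := by
  rw [sup_eq_sub_sup_zero_add]
  exact add_mem (hf.sup_zero_mem_span (sub_mem hx hy)) hy

theorem inf_mem_span (hf : IsLatticeMap f) {x y : V} (hx : x ∈ Submodule.span ℝ (Set.range f))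
    (hy : y ∈ Submodule.span ℝ (Set.range f)) : x ⊓ y ∈ Submodule.span ℝ (Set.range f) := by
  rw [inf_eq_sub_sub_sup_zero]
  exact sub_mem hx (hf.sup_zero_mem_span (sub_mem hx hy))

/-- Domination by a multiple of a single value is what later allows a truncation to be computed as a
meet. -/
theorem exists_le_smul (hf : IsLatticeMap f) {x : V}
    (hx : x ∈ Submodule.span ℝ (Set.range f)) : ∃ (r : ℝ) (a : A), 0 ≤ r ∧ x ≤ r • f a := by
  -- Both `x` and `-x` are bounded, because a negative scalar interchanges the two bounds in the
  -- induction.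
  suffices h : ∃ (r : ℝ) (a : A), 0 ≤ r ∧ x ≤ r • f a ∧ -x ≤ r • f a by
    obtain ⟨r, a, hr, h, -⟩ := h
    exact ⟨r, a, hr, h⟩
  have mono : ∀ {r r' : ℝ} {a a' : A}, 0 ≤ r → r ≤ r' → a ≤ a' → r • f a ≤ r' • f a' :=
    fun hr h h' => (smul_le_smul_of_nonneg_left (hf.mono h') hr).trans
      (smul_le_smul_of_nonneg_right h (hf.nonneg _))
  induction hx using Submodule.span_induction with
  | mem x hx =>
    obtain ⟨a, rfl⟩ := hx
    refine ⟨1, a, zero_le_one, by rw [one_smul], ?_⟩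
    rw [one_smul]
    exact (neg_nonpos.2 (hf.nonneg a)).trans (hf.nonneg a)
  | zero => exact ⟨0, ⊥, le_rfl, by simp, by simp⟩
  | add x y _ _ hx hy =>
    obtain ⟨r, a, hr, h1, h2⟩ := hx
    obtain ⟨s, b, hs, h3, h4⟩ := hy
    refine ⟨r + s, a ⊔ b, add_nonneg hr hs, ?_, ?_⟩ <;> rw [add_smul]
    · exact add_le_add (h1.trans (mono hr le_rfl le_sup_left))
        (h3.trans (mono hs le_rfl le_sup_right))
    · rw [neg_add]
      exact add_le_add (h2.trans (mono hr le_rfl le_sup_left))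
        (h4.trans (mono hs le_rfl le_sup_right))
  | smul c x _ hx =>
    obtain ⟨r, a, hr, h1, h2⟩ := hx
    refine ⟨|c| * r, a, by positivity, ?_⟩
    rw [mul_smul]
    rcases le_total 0 c with hc | hc
    · rw [abs_of_nonneg hc, ← smul_neg]
      exact ⟨smul_le_smul_of_nonneg_left h1 hc, smul_le_smul_of_nonneg_left h2 hc⟩
    · have e : c • x = (-c) • (-x) := by rw [neg_smul_neg]
      rw [abs_of_nonpos hc, e, ← smul_neg, neg_neg]
      exact ⟨smul_le_smul_of_nonneg_left h2 (by linarith),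
        smul_le_smul_of_nonneg_left h1 (by linarith)⟩

end IsLatticeMap

end LatticeMap

/-! ### Truncations in simple truncs -/

section

variable {G H : Type u} [TruncatedVectorLattice G] [TruncatedVectorLattice H]

theorem isLatticeMap_val : IsLatticeMap (fun u : UC G => u.1) :=
  ⟨rfl, fun _ _ => rfl, fun _ _ => rfl⟩

theorem range_val : Set.range (fun u : UC G => u.1) = {u : G | IsUnitalComponent u} :=
  Subtype.range_coe

/-- Iterates `(u + u) ⊓ d ≤ u`: doubling the bound for `n` gives `2 ^ (n + 1) • u ⊓ d ≤ u + u`, and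
a further meet with `d` brings this down to `u`. -/
theorem IsUnitalComponent.two_pow_smul_inf_le {u d : G} (hu : IsUnitalComponent u)
    (hd : d ∈ truncRange G) (n : ℕ) : ((2 : ℝ) ^ n • u) ⊓ d ≤ u := by
  have h2 := (isUnitalComponent_iff.1 hu).2 d hd
  induction n with
  | zero => rw [pow_zero, one_smul]; exact inf_le_left
  | succ n ih =>
    have e : ((2 : ℝ) ^ (n + 1) • u) ⊓ ((2 : ℝ) • d) = (2 : ℝ) • (((2 : ℝ) ^ n • u) ⊓ d) := by
      rw [pow_succ', mul_smul]
      exact ((OrderIso.smulRight (β := G) (a := (2 : ℝ)) (by norm_num)).map_inf _ _).symm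
    have h3 : ((2 : ℝ) ^ (n + 1) • u) ⊓ d ≤ u + u := by
      rw [← two_smul ℝ u]
      refine le_trans ?_ (smul_le_smul_of_nonneg_left ih zero_le_two)
      rw [← e]
      refine inf_le_inf_left _ ?_
      rw [two_smul]
      exact le_add_of_nonneg_left (nonneg_of_mem hd)
    exact (le_inf h3 inf_le_right).trans h2

/-- The truncation of `x` lies below some `2 ^ n • u`, hence below `u` by the doubling lemma;
conversely `u` is itself a truncation, so the first trunc axiom gives `x ⊓ u ≤ trunc x`. Thus below
multiples of `u` the truncation is a lattice operation. -/
theorem IsUnitalComponent.trunc_eq_inf {u : G} (hu : IsUnitalComponent u)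
    (x : {g : G // 0 ≤ g}) {r : ℝ} (h : (x : G) ≤ r • u) : (trunc x : G) = (x : G) ⊓ u := by
  refine le_antisymm (le_inf (TruncatedVectorLattice.trunc_le x) ?_) ?_
  · obtain ⟨n, hn⟩ := pow_unbounded_of_one_lt r (one_lt_two (α := ℝ))
    refine (le_inf ?_ le_rfl).trans (hu.two_pow_smul_inf_le ⟨x, rfl⟩ n)
    exact (TruncatedVectorLattice.trunc_le x).trans
      (h.trans (smul_le_smul_of_nonneg_right hn.le hu.nonneg))
  · obtain ⟨v, rfl⟩ := hu.1
    exact TruncatedVectorLattice.inf_trunc_le x v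

/-- A linear map out of a simple trunc which preserves positive parts and unital components is a
truncation homomorphism. -/
def TruncHom.ofLinearMap (hG : Submodule.span ℝ {u : G | IsUnitalComponent u} = ⊤)
    (f : G →ₗ[ℝ] H) (hf : ∀ x, f (x ⊔ 0) = f x ⊔ 0)
    (hu : ∀ u, IsUnitalComponent u → IsUnitalComponent (f u)) : TruncHom G H where
  toLinearMap := f
  map_sup' a b := by
    change f (a ⊔ b) = f a ⊔ f b
    rw [sup_eq_sub_sup_zero_add, sup_eq_sub_sup_zero_add (f a), f.map_add, hf, map_sub]
  map_inf' a b := by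
    change f (a ⊓ b) = f a ⊓ f b
    rw [inf_eq_sub_sub_sup_zero, inf_eq_sub_sub_sup_zero (f a), map_sub, hf, map_sub]
  map_trunc' x := by
    have hx : (x : G) ∈ Submodule.span ℝ (Set.range (fun u : UC G => u.1)) := by
      rw [range_val, hG]; trivial
    obtain ⟨r, u, -, h⟩ := isLatticeMap_val.exists_le_smul hx
    have mono : ∀ {a b : G}, a ≤ b → f a ≤ f b := by
      intro a b hab
      have h1 := hf (b - a)
      rw [sup_of_le_left (sub_nonneg.2 hab), map_sub] at h1
      exact sub_nonneg.1 (left_eq_sup.1 h1)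
    -- The same bound holds in `H`, so the truncations on both sides are meets, with `u` and with `f
    -- u`.
    have h' : f x ≤ r • f u.1 := by rw [← map_smul]; exact mono h
    change f (trunc x : G) = _
    rw [u.2.trunc_eq_inf x h, (hu u.1 u.2).trunc_eq_inf _ h']
    rw [inf_eq_sub_sub_sup_zero, map_sub, hf, map_sub]
    exact (inf_eq_sub_sub_sup_zero (f x) (f u.1)).symm

theorem TruncHom.eq_of_eqOn_unitalComponents
    (hG : Submodule.span ℝ {u : G | IsUnitalComponent u} = ⊤) {f g : TruncHom G H}
    (h : ∀ u, IsUnitalComponent u → f u = g u) : f = g := by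
  have e : f.toLinearMap = g.toLinearMap := LinearMap.ext_on hG fun u hu => h u hu
  exact TruncHom.ext fun x => LinearMap.congr_fun e x

/-- A morphism between the algebras of unital components extends to simple truncs. -/
theorem exists_truncHom_extending (hG : Submodule.span ℝ {u : G | IsUnitalComponent u} = ⊤)
    (φ : GenBoolHom (UC G) (UC H)) : ∃ f : TruncHom G H, ∀ u : UC G, f u.1 = (φ u).1 := by
  have hι : IsLatticeMap (fun u : UC G => ((u.1, (φ u).1) : G × H)) :=
    ⟨Prod.ext rfl (congrArg Subtype.val φ.map_bot'),
      fun a b => Prod.ext rfl (congrArg Subtype.val (φ.map_sup' a b)),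
      fun a b => Prod.ext rfl (congrArg Subtype.val (φ.map_inf' a b))⟩
  -- `K` will be the graph of the extension; the first projection `p` has to be shown bijective on
  -- it.
  set K := Submodule.span ℝ (Set.range (fun u : UC G => ((u.1, (φ u).1) : G × H)))
  have mem : ∀ u : UC G, ((u.1, (φ u).1) : G × H) ∈ K := fun u => Submodule.subset_span ⟨u, rfl⟩
  let p : K →ₗ[ℝ] G := (LinearMap.fst ℝ G H).comp K.subtype
  have inj : Function.Injective p := by
    rw [← LinearMap.ker_eq_bot, LinearMap.ker_eq_bot']
    rintro ⟨x, hx⟩ h0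
    -- With a disjoint representation, a zero first coordinate forces `c u = 0` or `u = ⊥` for each
    -- term; either way the whole pair vanishes.
    obtain ⟨t, c, hd, rfl⟩ := hι.exists_disjoint_sum hx
    refine Subtype.ext (Finset.sum_eq_zero fun u hu => ?_)
    have h0' : ∑ u ∈ t, c u • u.1 = 0 := by
      have : (∑ u ∈ t, c u • ((u.1, (φ u).1) : G × H)).1 = 0 := h0
      rw [Prod.fst_sum] at this
      exact this
    have h1 := smul_eq_zero_of_sum_smul_eq_zero t (fun u _ => u.2.nonneg)
      (fun a ha b hb h => isLatticeMap_val.inf_eq_zero (hd a ha b hb h)) c h0' u hu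
    rcases smul_eq_zero.1 h1 with h | h
    · rw [h, zero_smul]
    · have hu0 : u = ⊥ := Subtype.ext h
      rw [hu0]
      have : (((⊥ : UC G).1, (φ ⊥).1) : G × H) = 0 := hι.map_bot
      rw [this, smul_zero]
  have surj : Function.Surjective p := by
    rw [← LinearMap.range_eq_top, ← top_le_iff, ← hG, Submodule.span_le]
    intro u hu
    exact ⟨⟨_, mem ⟨u, hu⟩⟩, rfl⟩
  let e := LinearEquiv.ofBijective p ⟨inj, surj⟩
  let f : G →ₗ[ℝ] H := ((LinearMap.snd ℝ G H).comp K.subtype).comp e.symm.toLinearMap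
  have hf : ∀ {x : G} {y : H}, ((x, y) : G × H) ∈ K → f x = y := by
    intro x y h
    have h1 : e ⟨_, h⟩ = x := rfl
    have h2 : e.symm x = ⟨_, h⟩ := (LinearEquiv.symm_apply_eq e).2 h1.symm
    change (e.symm x).1.2 = y
    rw [h2]
  have hfu : ∀ u : UC G, f u.1 = (φ u).1 := fun u => hf (mem u)
  refine ⟨TruncHom.ofLinearMap hG f (fun x => ?_) fun u hu => ?_, hfu⟩
  · obtain ⟨⟨⟨x, y⟩, h⟩, rfl⟩ := surj x
    change f (x ⊔ 0) = f x ⊔ 0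
    rw [hf h]
    -- Lattice operations in `G × H` are coordinatewise, so the positive part of a point of the
    -- graph is `(x ⊔ 0, y ⊔ 0)`, again on the graph.
    exact hf (hι.sup_zero_mem_span h)
  · have h1 := hfu ⟨u, hu⟩
    rw [h1]
    exact (φ ⟨u, hu⟩).2

end

/-! ### The simple trunc of a generalized Boolean algebra -/

section Stone

variable {A : Type u} [GeneralizedBooleanAlgebra A]

open Classical in
/-- The indicator function of the set of prime ideals which do not contain `a`. -/
noncomputable def stoneMap (a : A) : {I : Order.Ideal A // I.IsPrime} → ℝ :=
  fun I => if a ∈ I.1 then 0 else 1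

theorem stoneMap_of_mem {a : A} {I : {I : Order.Ideal A // I.IsPrime}} (h : a ∈ I.1) :
    stoneMap a I = 0 := if_pos h

theorem stoneMap_of_notMem {a : A} {I : {I : Order.Ideal A // I.IsPrime}} (h : a ∉ I.1) :
    stoneMap a I = 1 := if_neg h

theorem isLatticeMap_stoneMap : IsLatticeMap (stoneMap (A := A)) where
  map_bot := funext fun I => stoneMap_of_mem I.1.bot_mem
  map_sup a b := by
    funext I
    rw [Pi.sup_apply]
    by_cases ha : a ∈ I.1 <;> by_cases hb : b ∈ I.1
    · rw [stoneMap_of_mem ha, stoneMap_of_mem hb, stoneMap_of_mem (Order.Ideal.sup_mem ha hb),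
        sup_idem]
    · rw [stoneMap_of_mem ha, stoneMap_of_notMem hb,
        stoneMap_of_notMem fun h => hb (I.1.lower le_sup_right h), sup_of_le_right zero_le_one]
    · rw [stoneMap_of_notMem ha, stoneMap_of_mem hb,
        stoneMap_of_notMem fun h => ha (I.1.lower le_sup_left h), sup_of_le_left zero_le_one]
    · rw [stoneMap_of_notMem ha, stoneMap_of_notMem hb,
        stoneMap_of_notMem fun h => hb (I.1.lower le_sup_right h), sup_idem]
  map_inf a b := by
    funext I
    rw [Pi.inf_apply]
    by_cases ha : a ∈ I.1 <;> by_cases hb : b ∈ I.1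
    · rw [stoneMap_of_mem ha, stoneMap_of_mem hb, stoneMap_of_mem (I.1.lower inf_le_left ha),
        inf_idem]
    · rw [stoneMap_of_mem ha, stoneMap_of_notMem hb,
        stoneMap_of_mem (I.1.lower inf_le_left ha), inf_of_le_left zero_le_one]
    · rw [stoneMap_of_notMem ha, stoneMap_of_mem hb,
        stoneMap_of_mem (I.1.lower inf_le_right hb), inf_of_le_right zero_le_one]
    · rw [stoneMap_of_notMem ha, stoneMap_of_notMem hb,
        stoneMap_of_notMem fun h => (I.2.mem_or_mem h).elim ha hb, inf_idem]

/-- If `a ≰ b`, the filter above `a` and the ideal below `b` are disjoint, so the prime ideal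
theorem yields a prime ideal containing `b` but not `a`, where the indicators take the values `0`
and `1`. -/
theorem le_of_stoneMap_le {a b : A} (h : stoneMap a ≤ stoneMap b) : a ≤ b := by
  by_contra hab
  have hd : Disjoint ((Order.PFilter.principal a : Order.PFilter A) : Set A)
      (Order.Ideal.principal b : Order.Ideal A) := by
    rw [Set.disjoint_left]
    intro x hx hx'
    exact hab ((Order.PFilter.mem_principal.1 hx).trans (Order.Ideal.mem_principal.1 hx'))
  obtain ⟨J, hJ, hbJ, haJ⟩ := DistribLattice.prime_ideal_of_disjoint_filter_ideal hd
  have hb : b ∈ J := hbJ (Order.Ideal.mem_principal.2 le_rfl)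
  have ha : a ∉ J := fun h => Set.disjoint_left.1 haJ (Order.PFilter.mem_principal.2 le_rfl) h
  have h1 := h ⟨J, hJ⟩
  rw [stoneMap_of_mem (I := ⟨J, hJ⟩) hb, stoneMap_of_notMem (I := ⟨J, hJ⟩) ha] at h1
  exact absurd h1 (by norm_num)

/-- The constant `1` need not lie in the span when `A` has no top. But `x ≤ r • stoneMap a` for some
`a`, so `x ≤ 0` wherever `stoneMap a` vanishes, and there meeting with `1` or with `stoneMap a`
leaves `x` unchanged. -/
theorem inf_one_mem_span_stoneMap {x : {I : Order.Ideal A // I.IsPrime} → ℝ}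
    (hx : x ∈ Submodule.span ℝ (Set.range (stoneMap (A := A)))) :
    x ⊓ 1 ∈ Submodule.span ℝ (Set.range (stoneMap (A := A))) := by
  obtain ⟨r, a, -, h⟩ := isLatticeMap_stoneMap.exists_le_smul hx
  have e : x ⊓ 1 = x ⊓ stoneMap a := by
    funext I
    rw [Pi.inf_apply, Pi.inf_apply]
    by_cases ha : a ∈ I.1
    · have h1 := h I
      rw [Pi.smul_apply, stoneMap_of_mem ha, smul_zero] at h1
      rw [stoneMap_of_mem ha, Pi.one_apply, inf_of_le_left h1,
        inf_of_le_left (h1.trans (zero_le_one (α := ℝ)))]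
    · rw [stoneMap_of_notMem ha, Pi.one_apply]
  rw [e]
  exact isLatticeMap_stoneMap.inf_mem_span hx (Submodule.subset_span ⟨a, rfl⟩)

/-- A function in the span of the indicators, all of whose values are `0` or `1`, is an
indicator. -/
theorem exists_stoneMap_eq {x : {I : Order.Ideal A // I.IsPrime} → ℝ}
    (hx : x ∈ Submodule.span ℝ (Set.range (stoneMap (A := A))))
    (h01 : ∀ I, x I = 0 ∨ x I = 1) : ∃ a : A, stoneMap a = x := by
  classical
  obtain ⟨t, c, hd, rfl⟩ := isLatticeMap_stoneMap.exists_disjoint_sum hx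
  -- The join of the pieces with coefficient `1`; every other piece has to contribute zero.
  refine ⟨(t.filter (c · = 1)).sup id, ?_⟩
  rw [isLatticeMap_stoneMap.map_finset_sup _ id fun a ha b hb =>
    hd a (Finset.mem_filter.1 ha).1 b (Finset.mem_filter.1 hb).1, Finset.sum_filter]
  refine Finset.sum_congr rfl fun a ha => ?_
  split_ifs with hc
  · rw [hc, one_smul, id]
  · funext I
    by_cases haI : a ∈ I.1
    · rw [Pi.smul_apply, stoneMap_of_mem haI, smul_zero, Pi.zero_apply]
    -- A prime ideal missing `a` contains everything disjoint from `a`, so at `I` only the term of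
    -- `a` survives. Hence `c a` is a value of the sum, and being different from `1` it is `0`.
    · have e : (∑ b ∈ t, c b • stoneMap b) I = c a := by
        rw [Finset.sum_apply, Finset.sum_eq_single_of_mem a ha, Pi.smul_apply,
          stoneMap_of_notMem haI, smul_eq_mul, mul_one]
        intro b hb hba
        have hbI : b ∈ I.1 := (I.2.mem_or_mem
          (by rw [(hd a ha b hb hba.symm).eq_bot]; exact I.1.bot_mem)).resolve_left haI
        rw [Pi.smul_apply, stoneMap_of_mem hbI, smul_zero]
      have h := h01 I
      rw [e] at h
      rw [Pi.smul_apply, h.resolve_right hc, zero_smul, Pi.zero_apply]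

variable (A)

/-- The functions on the prime spectrum of `A` spanned by the indicators of elements of `A`. -/
def StoneFun : Type u := Submodule.span ℝ (Set.range (stoneMap (A := A)))

namespace StoneFun

noncomputable instance : AddCommGroup (StoneFun A) :=
  inferInstanceAs (AddCommGroup (Submodule.span ℝ (Set.range (stoneMap (A := A)))))

noncomputable instance : Module ℝ (StoneFun A) :=
  inferInstanceAs (Module ℝ (Submodule.span ℝ (Set.range (stoneMap (A := A)))))

noncomputable instance : Lattice (StoneFun A) :=
  Subtype.lattice (fun _ _ hx hy => isLatticeMap_stoneMap.sup_mem_span hx hy)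
    (fun _ _ hx hy => isLatticeMap_stoneMap.inf_mem_span hx hy)

noncomputable instance : VectorLattice (StoneFun A) where
  add_le_add_left a b h c := add_le_add_left (show a.1 ≤ b.1 from h) c.1
  smul_le_smul_of_nonneg_left _ hc a b h :=
    smul_le_smul_of_nonneg_left (β := {I : Order.Ideal A // I.IsPrime} → ℝ)
      (show a.1 ≤ b.1 from h) hc
  smul_le_smul_of_nonneg_right x hx _ _ h :=
    smul_le_smul_of_nonneg_right (β := {I : Order.Ideal A // I.IsPrime} → ℝ) h
      (show 0 ≤ x.1 from hx)

noncomputable instance : TruncatedVectorLattice (StoneFun A) where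
  archimedean g h hg hgh := by
    refine Subtype.ext (funext fun I => le_antisymm ?_ (hg I))
    by_contra hI
    have hpos : 0 < g.1 I := not_le.1 hI
    obtain ⟨n, hn⟩ := exists_lt_nsmul hpos (h.1 I)
    have h1 : (n • g).1 I ≤ h.1 I := hgh n I
    exact absurd h1 (not_le.2 hn)
  trunc g := ⟨⟨g.1.1 ⊓ 1, inf_one_mem_span_stoneMap g.1.2⟩,
    fun I => le_inf (g.2 I) zero_le_one⟩
  inf_trunc_le g h := fun I => inf_le_inf_left (g.1.1 I) inf_le_right
  trunc_le g := fun I => inf_le_left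
  eq_zero_of_trunc_eq_zero g hg := by
    refine Subtype.ext (funext fun I => ?_)
    have h1 : g.1.1 I ⊓ 1 = 0 := congrFun (congrArg Subtype.val hg) I
    rcases min_choice (g.1.1 I) 1 with h | h
    · exact h.symm.trans h1
    · exact absurd (h.symm.trans h1) one_ne_zero
  eq_zero_of_nsmul_eq_trunc g hg := by
    refine Subtype.ext (funext fun I => le_antisymm ?_ (g.2 I))
    by_contra hI
    have hpos : 0 < g.1.1 I := not_le.1 hI
    -- A multiple exceeding `1` at `I` cannot equal its meet with `1`.
    obtain ⟨n, hn⟩ := exists_lt_nsmul hpos 1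
    have h1 : n • g.1.1 I = n • g.1.1 I ⊓ 1 := congrFun (congrArg Subtype.val (hg n)) I
    exact absurd (inf_eq_left.1 h1.symm) (not_le.2 hn)

variable {A}

/-- The element of `StoneFun A` given by `a`. -/
noncomputable def of (a : A) : StoneFun A := ⟨stoneMap a, Submodule.subset_span ⟨a, rfl⟩⟩

/-- Pointwise, being the truncation of one's double reads `t = min (2 * t) 1`, whose only solutions
are `0` and `1`. -/
theorem isUnitalComponent_iff {x : StoneFun A} : IsUnitalComponent x ↔ ∃ a, of a = x := by
  rw [isUnitalComponent_iff_trunc]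
  constructor
  · rintro ⟨_, h⟩
    obtain ⟨a, ha⟩ := exists_stoneMap_eq x.2 fun I => by
      have h1 : x.1 I = (x.1 I + x.1 I) ⊓ 1 := congrFun (congrArg Subtype.val h) I
      rcases min_choice (x.1 I + x.1 I) 1 with h | h
      · left; linarith [h1.trans h]
      · right; exact h1.trans h
    exact ⟨a, Subtype.ext ha⟩
  · rintro ⟨a, rfl⟩
    refine ⟨isLatticeMap_stoneMap.nonneg a, Subtype.ext (funext fun I => ?_)⟩
    change stoneMap a I = (stoneMap a I + stoneMap a I) ⊓ 1
    by_cases h : a ∈ I.1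
    · rw [stoneMap_of_mem h, add_zero, inf_of_le_left zero_le_one]
    · rw [stoneMap_of_notMem h, inf_of_le_right (by norm_num)]

theorem span_isUnitalComponent :
    Submodule.span ℝ {u : StoneFun A | IsUnitalComponent u} = ⊤ := by
  have h : {u : StoneFun A | IsUnitalComponent u} =
      {u : StoneFun A | u.1 ∈ Set.range (stoneMap (A := A))} := by
    ext u
    change IsUnitalComponent u ↔ ∃ a, stoneMap a = u.1
    rw [isUnitalComponent_iff]
    exact ⟨fun ⟨a, h⟩ => ⟨a, congrArg Subtype.val h⟩, fun ⟨a, h⟩ => ⟨a, Subtype.ext h⟩⟩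
  rw [h]
  exact Submodule.span_setOfPred_mem_eq_top

variable (A) in
/-- `A` is order isomorphic to the unital components of `StoneFun A`. -/
noncomputable def orderIsoUC : A ≃o UC (StoneFun A) :=
  RelIso.ofSurjective
    (OrderEmbedding.ofMapLEIff
      (fun a => (⟨of a, isUnitalComponent_iff.2 ⟨a, rfl⟩⟩ : UC (StoneFun A)))
      fun _ _ => ⟨le_of_stoneMap_le, isLatticeMap_stoneMap.mono⟩)
    fun ⟨_, hu⟩ => (isUnitalComponent_iff.1 hu).imp fun _ h => Subtype.ext h

end StoneFun

end Stone

/-! ### The equivalence of categories -/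

/-- An order isomorphism of generalized Boolean algebras as a morphism. -/
def GenBoolHom.ofOrderIso {A B : Type u} [GeneralizedBooleanAlgebra A]
    [GeneralizedBooleanAlgebra B] (e : A ≃o B) : GenBoolHom A B where
  toFun := e
  map_sup' := e.map_sup
  map_inf' := e.map_inf
  map_bot' := e.map_bot

/-- An order isomorphism of generalized Boolean algebras as an isomorphism in `GenBoolAlg`. -/
def GenBoolAlg.isoOfOrderIso {A B : GenBoolAlg.{u}} (e : A.carrier ≃o B.carrier) : A ≅ B where
  hom := GenBoolHom.ofOrderIso e
  inv := GenBoolHom.ofOrderIso e.symm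
  hom_inv_id := GenBoolHom.ext e.symm_apply_apply
  inv_hom_id := GenBoolHom.ext e.apply_symm_apply

instance : functorUC.{u}.Faithful where
  map_injective {G H f g} h := by
    have e : UC.map (G := G.obj.carrier) (H := H.obj.carrier) f.hom = UC.map g.hom := h
    exact ObjectProperty.hom_ext _ (TruncHom.eq_of_eqOn_unitalComponents G.property fun u hu => by
      have h1 := DFunLike.congr_fun e ⟨u, hu⟩
      exact congrArg Subtype.val h1)

instance : functorUC.{u}.Full where
  map_surjective {G H} φ := by
    obtain ⟨f, hf⟩ := exists_truncHom_extending (G := G.obj.carrier) (H := H.obj.carrier)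
      G.property φ
    exact ⟨ObjectProperty.homMk f, GenBoolHom.ext fun u => Subtype.ext (hf u)⟩

instance : functorUC.{u}.EssSurj where
  mem_essImage A :=
    ⟨⟨⟨StoneFun A.carrier⟩, StoneFun.span_isUnitalComponent⟩,
      ⟨(GenBoolAlg.isoOfOrderIso (A := A) (B := ⟨UC (StoneFun A.carrier)⟩)
        (StoneFun.orderIsoUC A.carrier)).symm⟩⟩

end SimpleTruncs

theorem theorem15 : SimpleTruncs.functorUC.{u}.IsEquivalence := by
  -- Instance search supplies the three fields: faithful, full and essentially surjective.
  exact { }
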